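/- For $u\in H^1(\mathbb{R}^2)\setminus\{0\}$ (complex-valued) and $0<\alpha<\infty$ let $$F_\alpha(u)=\frac{\|\nabla u\|_{L^2}^{\frac{2}{1+\alpha}}\,\|u\|_{L^2}^{\frac{2+\alpha}{1+\alpha}}\,\|u\|_{L^6}^{\frac{3\alpha}{1+\alpha}}}{\|u\|_{L^4}^{4}},\qquad C_\alpha=\inf_{u\in H^1(\mathbb{R}^2)\setminus\{0\}}F_\alpha(u).$$ For $\alpha>0$ let $Q_\alpha$ denote any positive, radially symmetric function in $H^1(\mathbb{R}^2)$ such that $F_\alpha(Q_\alpha)=C_\alpha$ and, in the weak sense, $$-\Delta Q_\alpha+Q_\alpha^5-Q_\alpha^3+\omega Q_\alpha=0\quad\text{on }\mathbb{R}^2,\qquad \omega=\frac{2+\alpha}{2}\,\frac{\|\nabla Q_\alpha\|_{L^2}^2}{\|Q_\alpha\|_{L^2}^2}.$$ Then, for every choice of the functions $Q_\alpha$, the maps $$\alpha\longmapsto\|\nabla Q_\alpha\|_{L^2}^2\qquad\text{and}\qquad \alpha\longmapsto\|Q_\alpha\|_{L^2}^2$$ are strictly increasing on $(0,\infty)$.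 More precisely, if $S\subseteq(0,\infty)$ and such a $Q_\alpha$ is chosen for each $\alpha\in S$, then both maps are strictly increasing on $S$ (the case $S=(0,\infty)$ being the assertion above). -/

import Mathlib

open MeasureTheory Set
open scoped ContDiff

namespace CubicQuintic

noncomputable section

/-- The plane `ℝ²` with its Euclidean norm and Lebesgue measure. -/
abbrev Plane : Type := EuclideanSpace ℝ (Fin 2)

/-- Test functions: the real-valued functions of class `C_c^∞(ℝ²)`. -/
def IsTestFunction (φ : Plane → ℝ) : Prop :=
  ContDiff ℝ ∞ φ ∧ HasCompactSupport φ

/-- The classical partial derivative `∂ᵢφ`. -/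
def partialDeriv (i : Fin 2) (φ : Plane → ℝ) (x : Plane) : ℝ :=
  fderiv ℝ φ x (EuclideanSpace.single i 1)

/-- `G = (G₁, G₂)` is a gradient of `u` in the sense of distributions:
`∫ u ∂ᵢφ = - ∫ Gᵢ φ` for all test functions `φ` and both `i`.
(It is only used for `u` and `G` in `L²`, where all these integrals converge.) -/
def HasWeakGradient (u : Plane → ℂ) (G : Plane → EuclideanSpace ℂ (Fin 2)) : Prop :=
  ∀ φ : Plane → ℝ, IsTestFunction φ → ∀ i : Fin 2,
    ∫ x, partialDeriv i φ x • u x = - ∫ x, φ x • G x i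

/-- `u ∈ H¹(ℝ²)` (complex-valued): `u` is in `L²` and has a distributional gradient in `L²`. -/
def MemH1 (u : Plane → ℂ) : Prop :=
  MemLp u 2 volume ∧
    ∃ G : Plane → EuclideanSpace ℂ (Fin 2), MemLp G 2 volume ∧ HasWeakGradient u G

open Classical in
/-- The weak gradient `∇u` of `u ∈ H¹(ℝ²)`, which is unique up to null sets
(by convention `0` if `u` is not in `H¹`). -/
def weakGradient (u : Plane → ℂ) : Plane → EuclideanSpace ℂ (Fin 2) :=
  if h : MemH1 u then h.2.choose else 0

/-- `‖∇u‖_{L²}`, where `|∇u|² = |∂₁u|² + |∂₂u|²`. -/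
def gradNorm (u : Plane → ℂ) : ℝ := lpNorm (weakGradient u) 2 volume

/-- The functional
`F_α(u) = ‖∇u‖₂^{2/(1+α)} ‖u‖₂^{(2+α)/(1+α)} ‖u‖₆^{3α/(1+α)} / ‖u‖₄⁴`. -/
def functionalF (α : ℝ) (u : Plane → ℂ) : ℝ :=
  gradNorm u ^ (2 / (1 + α)) * lpNorm u 2 volume ^ ((2 + α) / (1 + α)) *
      lpNorm u 6 volume ^ (3 * α / (1 + α)) /
    lpNorm u 4 volume ^ 4

/-- `C_α`, the infimum of `F_α` over `H¹(ℝ²) \ {0}`; elements of `H¹` are functions up to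
null sets, so `u ≠ 0` means that `u` does not vanish almost everywhere. -/
def infimumC (α : ℝ) : ℝ :=
  sInf (functionalF α '' {u : Plane → ℂ | MemH1 u ∧ ¬ u =ᵐ[volume] 0})

/-- `u ∈ H¹(ℝ²)` is a weak solution of `-Δu - |u|²u + |u|⁴u + wu = 0` on `ℝ²`. -/
def IsWeakSolution (w : ℝ) (u : Plane → ℂ) : Prop :=
  MemH1 u ∧ ∀ φ : Plane → ℝ, IsTestFunction φ →
    ∫ x, ((∑ i : Fin 2, partialDeriv i φ x • weakGradient u x i) +
      φ x • (-((‖u x‖ : ℂ) ^ 2 * u x) + (‖u x‖ : ℂ) ^ 4 * u x + (w : ℂ) * u x)) = 0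

/-- `Q` is a positive radially symmetric minimizer `Q_α` of `F_α` over `H¹(ℝ²) \ {0}`, normalized
so that `-ΔQ + Q⁵ - Q³ + ωQ = 0` with `ω = (2+α)/2 · ‖∇Q‖₂² / ‖Q‖₂²`. Positivity and radial
symmetry are properties of the class of `Q` up to null sets. -/
structure IsNormalizedMinimizer (α : ℝ) (Q : Plane → ℂ) : Prop where
  memH1 : MemH1 Q
  pos : ∀ᵐ x, 0 < (Q x).re ∧ (Q x).im = 0
  radial : ∃ q : ℝ → ℂ, ∀ᵐ x, Q x = q ‖x‖
  minimizes : functionalF α Q = infimumC α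
  solves : IsWeakSolution ((2 + α) / 2 * (gradNorm Q ^ 2 / lpNorm Q 2 volume ^ 2)) Q

end

end CubicQuintic

namespace CubicQuintic

theorem lpNorm_pow_eq_integral {α E : Type*} [MeasurableSpace α] [NormedAddCommGroup E]
    {μ : Measure α} {f : α → E} (n : ℕ) (hn : n ≠ 0) (hf : AEStronglyMeasurable f μ) :
    lpNorm f n μ ^ n = ∫ x, ‖f x‖ ^ n ∂μ := by
  rw [lpNorm_eq_integral_norm_rpow_toReal (by simpa using hn) (by simp) hf]
  simp only [ENNReal.toReal_natCast, Real.rpow_natCast]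
  exact Real.rpow_inv_natCast_pow (integral_nonneg fun x => by positivity) hn

/-- The logarithm of `F_α`, as a function of `‖∇u‖₂²`, `‖u‖₂²`, `‖u‖₆⁶` and `‖u‖₄⁴` and
multiplied by `2 (1 + α)`. -/
noncomputable def logQuotient (α a m b c : ℝ) : ℝ :=
  2 * Real.log a + (2 + α) * Real.log m + α * Real.log b - 2 * (1 + α) * Real.log c

theorem functionalF_pos {α : ℝ} {u : Plane → ℂ} (hg : 0 < gradNorm u)
    (h2 : 0 < lpNorm u 2 volume) (h6 : 0 < lpNorm u 6 volume) (h4 : 0 < lpNorm u 4 volume) :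
    0 < functionalF α u := by
  unfold functionalF
  positivity

theorem log_functionalF {α : ℝ} (hα : 0 < α) {u : Plane → ℂ} (hg : 0 < gradNorm u)
    (h2 : 0 < lpNorm u 2 volume) (h6 : 0 < lpNorm u 6 volume) (h4 : 0 < lpNorm u 4 volume) :
    2 * (1 + α) * Real.log (functionalF α u) =
      logQuotient α (gradNorm u ^ 2) (lpNorm u 2 volume ^ 2) (lpNorm u 6 volume ^ 6)
        (lpNorm u 4 volume ^ 4) := by
  unfold functionalF logQuotient
  rw [Real.log_div (by positivity) (by positivity), Real.log_mul (by positivity) (by positivity),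
    Real.log_mul (by positivity) (by positivity), Real.log_rpow hg, Real.log_rpow h2,
    Real.log_rpow h6]
  simp only [Real.log_pow]
  push_cast
  field_simp
  ring

theorem functionalF_nonneg (α : ℝ) (u : Plane → ℂ) : 0 ≤ functionalF α u := by
  unfold functionalF gradNorm
  have := lpNorm_nonneg (f := weakGradient u) (p := 2) (μ := volume)
  have := lpNorm_nonneg (f := u) (p := 2) (μ := volume)
  have := lpNorm_nonneg (f := u) (p := 6) (μ := volume)
  have := lpNorm_nonneg (f := u) (p := 4) (μ := volume)
  positivity

theorem infimumC_le (α : ℝ) {u : Plane → ℂ} (hu : MemH1 u) (h0 : ¬ u =ᵐ[volume] 0) :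
    infimumC α ≤ functionalF α u := by
  refine csInf_le ⟨0, ?_⟩ ⟨u, ⟨hu, h0⟩, rfl⟩
  rintro _ ⟨v, _, rfl⟩
  exact functionalF_nonneg α v

/-- If `‖u‖₆⁶ = (3α/2) a` and `‖u‖₄⁴ = 2(1+α) a` at the parameters `α < β`, and each of the two
states is optimal at its own parameter, then gradient and mass increase strictly. -/
theorem lt_of_logQuotient_le {α β a m a' m' : ℝ} (hα : 0 < α) (hαβ : α < β)
    (ha : 0 < a) (hm : 0 < m) (ha' : 0 < a') (hm' : 0 < m')
    (h1 : logQuotient α a m (3 / 2 * α * a) (2 * (1 + α) * a) ≤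
      logQuotient α a' m' (3 / 2 * β * a') (2 * (1 + β) * a'))
    (h2 : logQuotient β a' m' (3 / 2 * β * a') (2 * (1 + β) * a') ≤
      logQuotient β a m (3 / 2 * α * a) (2 * (1 + α) * a)) :
    a < a' ∧ m < m' := by
  have hβ : 0 < β := hα.trans hαβ
  have hb (γ x : ℝ) (hγ : 0 < γ) (hx : 0 < x) :
      Real.log (3 / 2 * γ * x) = Real.log (3 / 2) + Real.log γ + Real.log x := by
    rw [Real.log_mul (by positivity) hx.ne', Real.log_mul (by positivity) hγ.ne']
  have hc (γ x : ℝ) (hγ : 0 < γ) (hx : 0 < x) :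
      Real.log (2 * (1 + γ) * x) = Real.log 2 + Real.log (1 + γ) + Real.log x := by
    rw [Real.log_mul (by positivity) hx.ne', Real.log_mul (by positivity) (by positivity)]
  unfold logQuotient at h1 h2
  rw [hb α a hα ha, hc α a hα ha, hb β a' hβ ha', hc β a' hβ ha'] at h1 h2
  have hq : Real.log (1 + α) < Real.log (1 + β) := Real.log_lt_log (by linarith) (by linarith)
  have hpq : Real.log (1 + β) - Real.log (1 + α) < Real.log β - Real.log α := by
    rw [← Real.log_div (by positivity) (by positivity), ← Real.log_div hβ.ne' hα.ne']
    apply Real.log_lt_log (by positivity)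
    rw [div_lt_div_iff₀ (by positivity) hα]
    nlinarith
  have hd : 0 < β - α := sub_pos.2 hαβ
  have e1 := mul_le_mul_of_nonneg_left h1 hβ.le
  have e2 := mul_le_mul_of_nonneg_left h2 hα.le
  have e3 := mul_le_mul_of_nonneg_left h1 (show 0 ≤ 2 + β by linarith)
  have e4 := mul_le_mul_of_nonneg_left h2 (show 0 ≤ 2 + α by linarith)
  constructor
  · rw [← Real.log_lt_log_iff ha ha']
    by_contra hcon
    nlinarith [mul_pos hd (sub_pos.2 hpq), mul_nonneg hd.le (sub_nonneg.2 (not_lt.1 hcon))]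
  · rw [← Real.log_lt_log_iff hm hm']
    by_contra hcon
    nlinarith [mul_pos hd (sub_pos.2 hq), mul_nonneg hd.le (sub_nonneg.2 (not_lt.1 hcon))]

theorem integrable_pow_mul_pow {X : Type*} [MeasurableSpace X] {μ : Measure X} {f g : X → ℝ}
    {n : ℕ} (hn : n ≠ 0) (hf : MemLp f n μ) (hg : MemLp g n μ) {k l : ℕ} (hkl : k + l = n) :
    Integrable (fun x => f x ^ k * g x ^ l) μ := by
  have hF := hf.integrable_norm_pow hn
  have hG := hg.integrable_norm_pow hn
  refine (hF.add hG).mono' ((hf.1.pow k).mul (hg.1.pow l)) (.of_forall fun x => ?_)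
  rw [norm_mul, norm_pow, norm_pow, Pi.add_apply, ← hkl]
  have h1 : ‖f x‖ ≤ max ‖f x‖ ‖g x‖ := le_max_left _ _
  have h2 : ‖g x‖ ≤ max ‖f x‖ ‖g x‖ := le_max_right _ _
  calc ‖f x‖ ^ k * ‖g x‖ ^ l ≤ max ‖f x‖ ‖g x‖ ^ k * max ‖f x‖ ‖g x‖ ^ l := by gcongr
    _ = max ‖f x‖ ‖g x‖ ^ (k + l) := (pow_add _ _ _).symm
    _ ≤ ‖f x‖ ^ (k + l) + ‖g x‖ ^ (k + l) := by
      rcases max_choice ‖f x‖ ‖g x‖ with h | h <;> rw [h]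
      · exact le_add_of_nonneg_right (by positivity)
      · exact le_add_of_nonneg_left (by positivity)

theorem hasDerivAt_integral_add_mul_pow {X : Type*} [MeasurableSpace X] {μ : Measure X}
    {f g : X → ℝ} (n : ℕ) (hf : MemLp f (n + 1 : ℕ) μ) (hg : MemLp g (n + 1 : ℕ) μ) :
    HasDerivAt (fun t : ℝ => ∫ x, (f x + t * g x) ^ (n + 1) ∂μ)
      ((n + 1) * ∫ x, f x ^ n * g x ∂μ) 0 := by
  have hexp (t : ℝ) : ∫ x, (f x + t * g x) ^ (n + 1) ∂μ =
      ∑ k ∈ Finset.range (n + 1 + 1), t ^ (n + 1 - k) *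
        (((n + 1).choose k : ℝ) * ∫ x, f x ^ k * g x ^ (n + 1 - k) ∂μ) := by
    simp_rw [add_pow]
    rw [integral_finsetSum]
    · refine Finset.sum_congr rfl fun k _ => ?_
      rw [← integral_const_mul, ← integral_const_mul]
      congr with x
      rw [mul_pow]; ring
    · intro k hk
      have hk' : k + (n + 1 - k) = n + 1 := by have := Finset.mem_range.1 hk; omega
      refine ((integrable_pow_mul_pow (by simp) hf hg hk').const_mul
        (t ^ (n + 1 - k) * ((n + 1).choose k : ℝ))).congr (.of_forall fun x => ?_)
      simp only [mul_pow]; ring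
  simp_rw [hexp]
  have hs := HasDerivAt.fun_sum (u := Finset.range (n + 1 + 1))
    (A := fun k (t : ℝ) => t ^ (n + 1 - k) *
        (((n + 1).choose k : ℝ) * ∫ x, f x ^ k * g x ^ (n + 1 - k) ∂μ)) (x := (0 : ℝ))
    fun k _ => (hasDerivAt_pow (n + 1 - k) (0 : ℝ)).mul_const _
  refine hs.congr_deriv ?_
  rw [Finset.sum_eq_single_of_mem n (by simp)]
  · simp
  · intro k hk hkn
    have := Finset.mem_range.1 hk
    rcases Nat.lt_or_gt_of_ne hkn with h | h
    · rw [zero_pow (by omega)]; simp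
    · obtain rfl : k = n + 1 := by omega
      simp

open Filter Topology Convolution ENNReal NNReal ContinuousLinearMap

theorem sq_lintegral_mul_le {X : Type*} [MeasurableSpace X] {μ : Measure X} {f g : X → ℝ≥0∞}
    (hf : AEMeasurable f μ) (hg : AEMeasurable g μ) :
    (∫⁻ x, f x * g x ∂μ) ^ 2 ≤ (∫⁻ x, f x ^ 2 ∂μ) * ∫⁻ x, g x ^ 2 ∂μ := by
  have h := ENNReal.lintegral_mul_le_Lp_mul_Lq μ (p := 2) (q := 2)
    ⟨by norm_num, by norm_num, by norm_num⟩ hf hg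
  simp only [Pi.mul_apply, ENNReal.rpow_two] at h
  refine (pow_le_pow_left' h 2).trans_eq ?_
  rw [mul_pow, ← ENNReal.rpow_two, ← ENNReal.rpow_two, ← ENNReal.rpow_mul, ← ENNReal.rpow_mul]
  norm_num

theorem sq_add_le_two_mul (a b : ℝ≥0∞) : (a + b) ^ 2 ≤ 2 * (a ^ 2 + b ^ 2) := by
  have h := ENNReal.rpow_add_le_mul_rpow_add_rpow a b (p := 2) (by norm_num)
  norm_num at h
  exact h

/-- Mollification by a probability density does not increase the `L²` norm. -/
theorem lintegral_enorm_convolution_sq_le {ρ : Plane → ℝ} (hρ : Continuous ρ)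
    (hρ1 : ∫⁻ x, ‖ρ x‖ₑ = 1) {f : Plane → ℂ} (hf : AEStronglyMeasurable f volume) :
    ∫⁻ x, ‖(ρ ⋆[lsmul ℝ ℝ, volume] f) x‖ₑ ^ 2 ≤ ∫⁻ x, ‖f x‖ₑ ^ 2 := by
  have hpt (x : Plane) : ‖(ρ ⋆[lsmul ℝ ℝ, volume] f) x‖ₑ ^ 2 ≤
      ∫⁻ y, ‖ρ y‖ₑ * ‖f (x - y)‖ₑ ^ 2 := by
    have hfx : AEStronglyMeasurable (fun y => f (x - y)) volume :=
      hf.comp_quasiMeasurePreserving (quasiMeasurePreserving_sub_left volume x)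
    have hsq : AEMeasurable (fun y => ‖ρ y‖ₑ ^ (1 / 2 : ℝ)) volume := by fun_prop
    have hroot (y : Plane) : ‖ρ y‖ₑ ^ (1 / 2 : ℝ) * ‖ρ y‖ₑ ^ (1 / 2 : ℝ) = ‖ρ y‖ₑ := by
      rw [← ENNReal.rpow_add_of_nonneg _ _ (by norm_num) (by norm_num)]; norm_num
    calc ‖(ρ ⋆[lsmul ℝ ℝ, volume] f) x‖ₑ ^ 2
        ≤ (∫⁻ y, ‖ρ y‖ₑ ^ (1 / 2 : ℝ) * (‖ρ y‖ₑ ^ (1 / 2 : ℝ) * ‖f (x - y)‖ₑ)) ^ 2 := by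
          gcongr
          rw [convolution_def]
          refine (enorm_integral_le_lintegral_enorm _).trans_eq ?_
          refine lintegral_congr fun y => ?_
          rw [← mul_assoc, hroot, lsmul_apply, enorm_smul]
      _ ≤ (∫⁻ y, (‖ρ y‖ₑ ^ (1 / 2 : ℝ)) ^ 2) *
            ∫⁻ y, (‖ρ y‖ₑ ^ (1 / 2 : ℝ) * ‖f (x - y)‖ₑ) ^ 2 :=
          sq_lintegral_mul_le hsq (hsq.mul hfx.enorm)
      _ = ∫⁻ y, ‖ρ y‖ₑ * ‖f (x - y)‖ₑ ^ 2 := by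
          simp_rw [mul_pow, pow_two (‖ρ _‖ₑ ^ (1 / 2 : ℝ)), hroot]
          rw [hρ1, one_mul]
  have hmeas : AEMeasurable (Function.uncurry fun x y : Plane => ‖ρ y‖ₑ * ‖f (x - y)‖ₑ ^ 2)
      (volume.prod volume) := by
    have h := (AEStronglyMeasurable.convolution_integrand (lsmul ℝ ℝ)
      (μ := (volume : Measure Plane)) (ν := (volume : Measure Plane))
      hρ.aestronglyMeasurable (hf.norm.pow 2)).enorm
    refine h.congr (.of_forall fun p => ?_)
    simp [Function.uncurry, enorm_mul, enorm_pow]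
  calc ∫⁻ x, ‖(ρ ⋆[lsmul ℝ ℝ, volume] f) x‖ₑ ^ 2
      ≤ ∫⁻ x, ∫⁻ y, ‖ρ y‖ₑ * ‖f (x - y)‖ₑ ^ 2 := lintegral_mono hpt
    _ = ∫⁻ y, ∫⁻ x, ‖ρ y‖ₑ * ‖f (x - y)‖ₑ ^ 2 := lintegral_lintegral_swap hmeas
    _ = ∫⁻ y, ‖ρ y‖ₑ * ∫⁻ x, ‖f x‖ₑ ^ 2 := by
        refine lintegral_congr fun y => ?_
        rw [lintegral_const_mul' _ _ enorm_ne_top,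
          lintegral_sub_right_eq_self (fun x => ‖f x‖ₑ ^ 2) y]
    _ = ∫⁻ x, ‖f x‖ₑ ^ 2 := by
        rw [lintegral_mul_const'' _ (by fun_prop), hρ1, one_mul]

/-- The Gagliardo–Nirenberg inequality on the plane, applied to the power `w ^ (n + 1)`. -/
theorem lintegral_enorm_pow_le {w : Plane → ℂ} (hw : ContDiff ℝ 1 w) (hc : HasCompactSupport w)
    (n : ℕ) :
    ∫⁻ x, ‖w x‖ₑ ^ (2 * (n + 1)) ≤
      lintegralPowLePowLIntegralFDerivConst (volume : Measure Plane) 2 * (n + 1) ^ 2 *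
        ((∫⁻ x, ‖w x‖ₑ ^ (2 * n)) * ∫⁻ x, ‖fderiv ℝ w x‖ₑ ^ 2) := by
  have hfd (x : Plane) : ‖fderiv ℝ (fun y => w y ^ (n + 1)) x‖ₑ =
      (n + 1) * (‖w x‖ₑ ^ n * ‖fderiv ℝ w x‖ₑ) := by
    have h := ((hw.differentiable one_ne_zero x).hasFDerivAt.pow (n + 1)).fderiv
    have h' : fderiv ℝ (fun y => w y ^ (n + 1)) x = _ := h
    rw [h', enorm_smul]
    simp only [Nat.add_sub_cancel, ← Nat.cast_succ]
    rw [nsmul_eq_mul, enorm_mul, enorm_pow, mul_assoc]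
    congr 1
    rw [← ofReal_norm, Complex.norm_natCast, ENNReal.ofReal_natCast]
  have h := lintegral_pow_le_pow_lintegral_fderiv (volume : Measure Plane)
    (u := fun x => w x ^ (n + 1)) (hw.pow _)
    (hc.comp_left (g := fun z : ℂ => z ^ (n + 1)) (by simp)) (p := 2)
    (by simpa using ⟨by norm_num, by norm_num, by norm_num⟩)
  simp only [ENNReal.rpow_two, hfd, enorm_pow] at h
  have hDw : Continuous (fderiv ℝ w) := hw.continuous_fderiv one_ne_zero
  have hwc := hw.continuous
  rw [lintegral_const_mul _ (by fun_prop), mul_pow] at h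
  calc ∫⁻ x, ‖w x‖ₑ ^ (2 * (n + 1)) = ∫⁻ x, (‖w x‖ₑ ^ (n + 1)) ^ 2 := by
        simp_rw [← pow_mul, mul_comm]
    _ ≤ _ := h
    _ ≤ _ := by
        rw [mul_assoc]
        gcongr
        refine (sq_lintegral_mul_le (by fun_prop) (by fun_prop)).trans_eq ?_
        simp_rw [← pow_mul, mul_comm n 2]

theorem lintegral_enorm_pow_six_le {w : Plane → ℂ} (hw : ContDiff ℝ 1 w)
    (hc : HasCompactSupport w) {A B : ℝ≥0∞} (hA : ∫⁻ x, ‖w x‖ₑ ^ 2 ≤ A)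
    (hB : ∫⁻ x, ‖fderiv ℝ w x‖ₑ ^ 2 ≤ B) :
    ∫⁻ x, ‖w x‖ₑ ^ 6 ≤
      lintegralPowLePowLIntegralFDerivConst (volume : Measure Plane) 2 * 9 *
        ((lintegralPowLePowLIntegralFDerivConst (volume : Measure Plane) 2 * 4 * (A * B)) * B) := by
  have h1 := lintegral_enorm_pow_le hw hc 1
  have h2 := lintegral_enorm_pow_le hw hc 2
  norm_num at h1 h2
  refine h2.trans ?_
  gcongr
  refine h1.trans ?_
  gcongr

theorem enorm_clm_le (L : Plane →L[ℝ] ℂ) :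
    ‖L‖ₑ ≤ ‖L (EuclideanSpace.single 0 1)‖ₑ + ‖L (EuclideanSpace.single 1 1)‖ₑ := by
  have h : ‖L‖ ≤ ‖L (EuclideanSpace.single 0 1)‖ + ‖L (EuclideanSpace.single 1 1)‖ := by
    refine L.opNorm_le_bound (by positivity) fun x => ?_
    have hx : x = x 0 • EuclideanSpace.single 0 (1 : ℝ) + x 1 • EuclideanSpace.single 1 (1 : ℝ) := by
      ext i; fin_cases i <;> simp
    conv_lhs => rw [hx, map_add, map_smul, map_smul]
    refine (norm_add_le _ _).trans ?_
    rw [norm_smul, norm_smul, add_mul, mul_comm ‖x 0‖, mul_comm ‖x 1‖]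
    gcongr <;> exact PiLp.norm_apply_le x _
  rw [← ofReal_norm, ← ofReal_norm, ← ofReal_norm, ← ENNReal.ofReal_add (by positivity) (by positivity)]
  exact ENNReal.ofReal_le_ofReal h

theorem fderiv_mollification {ρ : Plane → ℝ} (hρ : IsTestFunction ρ) {u : Plane → ℂ}
    {G : Plane → EuclideanSpace ℂ (Fin 2)} (hu : LocallyIntegrable u volume)
    (hG : HasWeakGradient u G) (x : Plane) (i : Fin 2) :
    fderiv ℝ (ρ ⋆[lsmul ℝ ℝ, volume] u) x (EuclideanSpace.single i 1) =
      (ρ ⋆[lsmul ℝ ℝ, volume] fun y => G y i) x := by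
  have hρ1 : ContDiff ℝ 1 ρ := hρ.1.of_le (by exact_mod_cast le_top)
  rw [(hρ.2.hasFDerivAt_convolution_left (lsmul ℝ ℝ) hρ1 hu x).fderiv, convolution_eq_swap,
    convolution_eq_swap, ContinuousLinearMap.integral_apply]
  · have htest : IsTestFunction fun y => ρ (x - y) :=
      ⟨hρ.1.comp (contDiff_const.sub contDiff_id),
        hρ.2.comp_homeomorph (Homeomorph.subLeft x)⟩
    have h := hG _ htest i
    have hpd (y : Plane) : partialDeriv i (fun y => ρ (x - y)) y =
        -fderiv ℝ ρ (x - y) (EuclideanSpace.single i 1) := by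
      unfold partialDeriv
      have hd : HasFDerivAt (fun y => ρ (x - y)) _ y :=
        (hρ.1.differentiable (by simp) (x - y)).hasFDerivAt.comp y ((hasFDerivAt_id y).const_sub x)
      rw [hd.fderiv]
      simp
    simp only [hpd, neg_smul, integral_neg, neg_inj] at h
    simpa [precompL_apply] using h
  · have := ((hρ.2.fderiv ℝ).convolutionExists_left (L := (lsmul ℝ ℝ).precompL Plane)
      (hρ1.continuous_fderiv one_ne_zero) hu x).integrable_swap
    exact this

theorem enorm_fderiv_smul_le {χ : Plane → ℝ} {v : Plane → ℂ} (hχ : ContDiff ℝ 1 χ)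
    (hv : ContDiff ℝ 1 v) {K : ℝ≥0} (h1 : ∀ x, ‖χ x‖ₑ ≤ 1) (hK : ∀ x, ‖fderiv ℝ χ x‖ₑ ≤ K)
    (x : Plane) :
    ‖fderiv ℝ (fun y => χ y • v y) x‖ₑ ≤ ‖fderiv ℝ v x‖ₑ + K * ‖v x‖ₑ := by
  rw [fderiv_fun_smul (hχ.differentiable one_ne_zero x) (hv.differentiable one_ne_zero x)]
  refine (enorm_add_le (E := Plane →L[ℝ] ℂ) _ _).trans (add_le_add ?_ ?_)
  · rw [enorm_smul]
    exact mul_le_of_le_one_left' (h1 x)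
  · have : ‖(fderiv ℝ χ x).smulRight (v x)‖ₑ = ‖fderiv ℝ χ x‖ₑ * ‖v x‖ₑ := by
      rw [← ofReal_norm, norm_smulRight_apply, ENNReal.ofReal_mul (norm_nonneg _), ofReal_norm,
        ofReal_norm]
    rw [this]
    gcongr
    exact hK x

/-- Smooth cutoffs with uniformly bounded gradients exhausting the plane. -/
theorem exists_cutoff : ∃ (χ : ℕ → Plane → ℝ) (K : ℝ≥0),
    (∀ n, ContDiff ℝ 1 (χ n)) ∧ (∀ n, HasCompactSupport (χ n)) ∧ (∀ n x, ‖χ n x‖ₑ ≤ 1) ∧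
    (∀ n x, ‖fderiv ℝ (χ n) x‖ₑ ≤ K) ∧ ∀ x, Tendsto (fun n => χ n x) atTop (𝓝 1) := by
  let f : ContDiffBump (0 : Plane) := ⟨1, 2, one_pos, one_lt_two⟩
  have hf1 : ContDiff ℝ 1 f := f.contDiff
  obtain ⟨K, hK⟩ := (hf1.continuous_fderiv one_ne_zero).bounded_above_of_compact_support
    (f.hasCompactSupport.fderiv ℝ)
  let c : ℕ → ℝ := fun n => 1 / ((n : ℝ) + 1)
  have hc0 (n : ℕ) : 0 < c n := by positivity
  have hc1 (n : ℕ) : c n ≤ 1 := by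
    simp only [c]; rw [div_le_one (by positivity)]; linarith [Nat.cast_nonneg (α := ℝ) n]
  refine ⟨fun n x => f (c n • x), K.toNNReal, fun n => hf1.comp (contDiff_const_smul _),
    fun n => f.hasCompactSupport.comp_smul (hc0 n).ne', fun n x => ?_, fun n x => ?_, fun x => ?_⟩
  · rw [Real.enorm_of_nonneg f.nonneg]
    exact ENNReal.ofReal_le_one.2 f.le_one
  · have h : fderiv ℝ (fun x => f (c n • x)) x = c n • fderiv ℝ f (c n • x) := by
      rw [fderiv_comp_smul]
    rw [h, ← ofReal_norm, norm_smul, ENNReal.ofNNReal_toNNReal]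
    refine ENNReal.ofReal_le_ofReal ?_
    rw [Real.norm_of_nonneg (hc0 n).le]
    exact (mul_le_of_le_one_left (norm_nonneg _) (hc1 n)).trans (hK _)
  · have h : Tendsto (fun n => c n • x) atTop (𝓝 0) := by
      simpa [c] using (tendsto_one_div_add_atTop_nhds_zero_nat (𝕜 := ℝ)).smul_const x
    exact tendsto_const_nhds.congr' ((h.eventually f.eventuallyEq_one).mono fun n hn => hn.symm)

theorem memLp_coord {G : Plane → EuclideanSpace ℂ (Fin 2)} {p : ENNReal} (hG : MemLp G p volume)
    (i : Fin 2) : MemLp (fun x => G x i) p volume :=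
  hG.mono ((EuclideanSpace.proj i :
    EuclideanSpace ℂ (Fin 2) →L[ℂ] ℂ).continuous.comp_aestronglyMeasurable hG.1)
    (.of_forall fun _ => PiLp.norm_apply_le _ _)

/-- The Sobolev embedding `H¹(ℝ²) ⊆ L⁶(ℝ²)`. -/
theorem MemH1.memLp_six {u : Plane → ℂ} (hu : MemH1 u) : MemLp u 6 volume := by
  obtain ⟨hu2, G, hG2, hG⟩ := hu
  obtain ⟨χ, K, hχ, hχc, hχ1, hχK, hχt⟩ := exists_cutoff
  have huloc := hu2.locallyIntegrable one_le_two
  let ρ : ℕ → ContDiffBump (0 : Plane) := fun n =>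
    ⟨1 / ((n : ℝ) + 1), 2 * (1 / ((n : ℝ) + 1)), by positivity,
      lt_mul_left (by positivity) one_lt_two⟩
  let r : ℕ → Plane → ℝ := fun n => (ρ n).normed volume
  have hr (n) : IsTestFunction (r n) := ⟨(ρ n).contDiff_normed, (ρ n).hasCompactSupport_normed⟩
  have hr1 (n) : ∫⁻ x, ‖r n x‖ₑ = 1 := by
    have h := (ρ n).integral_normed (μ := (volume : Measure Plane))
    rw [integral_eq_lintegral_of_nonneg_ae (.of_forall (ρ n).nonneg_normed)
      (hr n).1.continuous.aestronglyMeasurable, ENNReal.toReal_eq_one_iff] at h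
    rw [← h]
    exact lintegral_congr fun x => Real.enorm_of_nonneg ((ρ n).nonneg_normed x)
  let v : ℕ → Plane → ℂ := fun n => r n ⋆[lsmul ℝ ℝ, volume] u
  have hv (n) : ContDiff ℝ 1 (v n) :=
    (hr n).2.contDiff_convolution_left (lsmul ℝ ℝ) ((hr n).1.of_le (by exact_mod_cast le_top)) huloc
  let w : ℕ → Plane → ℂ := fun n x => χ n x • v n x
  have hw (n) : ContDiff ℝ 1 (w n) := (hχ n).smul (hv n)
  have hwc (n) : HasCompactSupport (w n) := (hχc n).smul_right
  have hGi (i : Fin 2) : MemLp (fun x => G x i) 2 volume := memLp_coord hG2 i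
  have hfin {f : Plane → ℂ} (hf : MemLp f 2 volume) : ∫⁻ x, ‖f x‖ₑ ^ 2 < ⊤ := by
    have := lintegral_rpow_enorm_lt_top_of_eLpNorm_lt_top (by norm_num) (by norm_num) hf.2
    simpa using this
  set A := ∫⁻ x, ‖u x‖ₑ ^ 2
  set B := 2 * (2 * ((∫⁻ x, ‖G x 0‖ₑ ^ 2) + ∫⁻ x, ‖G x 1‖ₑ ^ 2) + K ^ 2 * A) with hB
  have hvA (n) : ∫⁻ x, ‖v n x‖ₑ ^ 2 ≤ A :=
    lintegral_enorm_convolution_sq_le (hr n).1.continuous (hr1 n) hu2.1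
  have hwA (n) : ∫⁻ x, ‖w n x‖ₑ ^ 2 ≤ A := by
    refine (lintegral_mono fun x => ?_).trans (hvA n)
    gcongr
    rw [enorm_smul]
    exact mul_le_of_le_one_left' (hχ1 n x)
  have hdv (n) (i : Fin 2) :
      ∫⁻ x, ‖fderiv ℝ (v n) x (EuclideanSpace.single i 1)‖ₑ ^ 2 ≤ ∫⁻ x, ‖G x i‖ₑ ^ 2 := by
    simp_rw [v, fderiv_mollification (hr n) huloc hG]
    exact lintegral_enorm_convolution_sq_le (hr n).1.continuous (hr1 n) (hGi i).1
  have hwB (n) : ∫⁻ x, ‖fderiv ℝ (w n) x‖ₑ ^ 2 ≤ B := by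
    have hdc : Continuous (fderiv ℝ (v n)) := (hv n).continuous_fderiv one_ne_zero
    have hvc := (hv n).continuous
    calc ∫⁻ x, ‖fderiv ℝ (w n) x‖ₑ ^ 2
        ≤ ∫⁻ x, 2 * (2 * (‖fderiv ℝ (v n) x (EuclideanSpace.single 0 1)‖ₑ ^ 2 +
            ‖fderiv ℝ (v n) x (EuclideanSpace.single 1 1)‖ₑ ^ 2) + K ^ 2 * ‖v n x‖ₑ ^ 2) := by
          refine lintegral_mono fun x => ?_
          refine (pow_le_pow_left' (enorm_fderiv_smul_le (hχ n) (hv n) (hχ1 n) (hχK n) x) 2).trans ?_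
          refine (sq_add_le_two_mul _ _).trans ?_
          rw [mul_pow]
          gcongr
          exact (pow_le_pow_left' (enorm_clm_le _) 2).trans (sq_add_le_two_mul _ _)
      _ = 2 * (2 * ((∫⁻ x, ‖fderiv ℝ (v n) x (EuclideanSpace.single 0 1)‖ₑ ^ 2) +
            ∫⁻ x, ‖fderiv ℝ (v n) x (EuclideanSpace.single 1 1)‖ₑ ^ 2) +
            K ^ 2 * ∫⁻ x, ‖v n x‖ₑ ^ 2) := by
          rw [lintegral_const_mul _ (by fun_prop), lintegral_add_left (by fun_prop),
            lintegral_const_mul _ (by fun_prop), lintegral_add_left (by fun_prop),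
            lintegral_const_mul _ (by fun_prop)]
      _ ≤ B := by
          rw [hB]
          have h0 := hdv n 0
          have h1 := hdv n 1
          have h2 := hvA n
          exact mul_le_mul_right (add_le_add (mul_le_mul_right (add_le_add h0 h1) _)
            (mul_le_mul_right h2 _)) _
  have hlim : ∀ᵐ x, Tendsto (fun n => w n x) atTop (𝓝 (u x)) := by
    have h0 : Tendsto (fun n : ℕ => 2 * (1 / ((n : ℝ) + 1))) atTop (𝓝 0) := by
      simpa using (tendsto_one_div_add_atTop_nhds_zero_nat (𝕜 := ℝ)).const_mul 2
    filter_upwards [ContDiffBump.ae_convolution_tendsto_right_of_locallyIntegrable (φ := ρ) (K := 2)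
      h0 (.of_forall fun n => le_rfl) huloc] with x hx
    simpa only [one_smul] using (hχt x).smul hx
  refine ⟨hu2.1, ?_⟩
  rw [eLpNorm_lt_top_iff_lintegral_rpow_enorm_lt_top (by norm_num) (by norm_num)]
  have h6 : ∫⁻ x, ‖u x‖ₑ ^ 6 ≤
      lintegralPowLePowLIntegralFDerivConst (volume : Measure Plane) 2 * 9 *
        ((lintegralPowLePowLIntegralFDerivConst (volume : Measure Plane) 2 * 4 * (A * B)) * B) := by
    calc ∫⁻ x, ‖u x‖ₑ ^ 6 = ∫⁻ x, liminf (fun n => ‖w n x‖ₑ ^ 6) atTop := by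
          refine lintegral_congr_ae (hlim.mono fun x hx => ?_)
          exact (((ENNReal.continuous_pow 6).tendsto _).comp hx.enorm).liminf_eq.symm
      _ ≤ liminf (fun n => ∫⁻ x, ‖w n x‖ₑ ^ 6) atTop :=
          lintegral_liminf_le fun n => by have := (hw n).continuous; fun_prop
      _ ≤ _ := liminf_le_of_le (by isBoundedDefault) fun b hb => by
          obtain ⟨n, hn⟩ := hb.exists
          exact hn.trans (lintegral_enorm_pow_six_le (hw n) (hwc n) (hwA n) (hwB n))
  have hAt : A < ⊤ := hfin hu2
  have h0t := hfin (hGi 0)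
  have h1t := hfin (hGi 1)
  have hBt : B < ⊤ := by
    rw [hB]
    refine ENNReal.mul_lt_top (by simp) (ENNReal.add_lt_top.2 ⟨ENNReal.mul_lt_top (by simp)
      (ENNReal.add_lt_top.2 ⟨h0t, h1t⟩), ENNReal.mul_lt_top (by simp) hAt⟩)
  refine lt_of_le_of_lt ?_ (h6.trans_lt ?_)
  · simp only [ENNReal.toReal_ofNat]
    exact le_of_eq (lintegral_congr fun x => by norm_cast)
  · exact ENNReal.mul_lt_top (ENNReal.mul_lt_top (by simp) (by simp)) (ENNReal.mul_lt_top
      (ENNReal.mul_lt_top (ENNReal.mul_lt_top (by simp) (by simp)) (ENNReal.mul_lt_top hAt hBt)) hBt)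

open Filter Topology

theorem IsTestFunction.memLp {φ : Plane → ℝ} (hφ : IsTestFunction φ) (p : ENNReal) :
    MemLp φ p volume :=
  hφ.1.continuous.memLp_of_hasCompactSupport hφ.2

theorem IsTestFunction.continuous_partialDeriv {φ : Plane → ℝ} (hφ : IsTestFunction φ)
    (i : Fin 2) : Continuous (partialDeriv i φ) :=
  (hφ.1.continuous_fderiv (by simp)).clm_apply continuous_const

theorem IsTestFunction.hasCompactSupport_partialDeriv {φ : Plane → ℝ} (hφ : IsTestFunction φ)
    (i : Fin 2) : HasCompactSupport (partialDeriv i φ) :=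
  hφ.2.fderiv_apply ℝ _

theorem IsTestFunction.memLp_partialDeriv {φ : Plane → ℝ} (hφ : IsTestFunction φ)
    (i : Fin 2) (p : ENNReal) : MemLp (partialDeriv i φ) p volume :=
  (hφ.continuous_partialDeriv i).memLp_of_hasCompactSupport (hφ.hasCompactSupport_partialDeriv i)

theorem MemH1.memLp_weakGradient {u : Plane → ℂ} (hu : MemH1 u) :
    MemLp (weakGradient u) 2 volume := by
  rw [weakGradient, dif_pos hu]
  exact hu.2.choose_spec.1

theorem MemH1.hasWeakGradient {u : Plane → ℂ} (hu : MemH1 u) :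
    HasWeakGradient u (weakGradient u) := by
  rw [weakGradient, dif_pos hu]
  exact hu.2.choose_spec.2

/-- Weak gradients are unique up to null sets. -/
theorem HasWeakGradient.ae_eq {u : Plane → ℂ} {G G' : Plane → EuclideanSpace ℂ (Fin 2)}
    (h : HasWeakGradient u G) (h' : HasWeakGradient u G') (hG : MemLp G 2 volume)
    (hG' : MemLp G' 2 volume) : G =ᵐ[volume] G' := by
  have hi (i : Fin 2) : ∀ᵐ x, G x i = G' x i :=
    ae_eq_of_integral_contDiff_smul_eq ((memLp_coord hG i).locallyIntegrable one_le_two)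
      ((memLp_coord hG' i).locallyIntegrable one_le_two) fun φ h1 h2 => by
        have := (h φ ⟨h1, h2⟩ i).symm.trans (h' φ ⟨h1, h2⟩ i)
        exact neg_injective this
  filter_upwards [ae_all_iff.2 hi] with x hx
  ext i
  exact hx i

/-- The classical gradient of a real function, with complex entries. -/
noncomputable def classicalGradient (φ : Plane → ℝ) (x : Plane) : EuclideanSpace ℂ (Fin 2) :=
  WithLp.toLp 2 fun i => (partialDeriv i φ x : ℂ)

theorem IsTestFunction.memLp_classicalGradient {φ : Plane → ℝ} (hφ : IsTestFunction φ) :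
    MemLp (classicalGradient φ) 2 volume := by
  refine Continuous.memLp_of_hasCompactSupport ?_ ?_
  · refine (PiLp.continuous_toLp 2 _).comp (continuous_pi fun i => ?_)
    exact Complex.continuous_ofReal.comp (hφ.continuous_partialDeriv i)
  · refine (hφ.2.fderiv ℝ).mono' (Function.support_subset_iff'.2 fun x hx => ?_)
    have h0 : fderiv ℝ φ x = 0 := image_eq_zero_of_notMem_tsupport hx
    ext i
    simp [classicalGradient, partialDeriv, h0]

theorem IsTestFunction.hasWeakGradient {φ : Plane → ℝ} (hφ : IsTestFunction φ) :
    HasWeakGradient (fun x => (φ x : ℂ)) (classicalGradient φ) := by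
  intro ψ hψ i
  have h := integral_mul_fderiv_eq_neg_fderiv_mul_of_integrable (μ := (volume : Measure Plane))
    (f := φ) (g := ψ) (v := EuclideanSpace.single i 1)
    (((hφ.memLp_partialDeriv i 2).integrable_mul (hψ.memLp 2)))
    ((hφ.memLp 2).integrable_mul (hψ.memLp_partialDeriv i 2))
    ((hφ.memLp 2).integrable_mul (hψ.memLp 2))
    (fun x _ => hφ.1.differentiable (by simp) x) (fun x _ => hψ.1.differentiable (by simp) x)
  have h' := congrArg (fun r : ℝ => (r : ℂ)) h
  simp only [← integral_complex_ofReal, Complex.ofReal_neg, Complex.ofReal_mul] at h'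
  simp only [classicalGradient, Complex.real_smul, partialDeriv]
  simp only [mul_comm] at h' ⊢
  exact h'

theorem hasWeakGradient_add_smul {u v : Plane → ℂ} {G H : Plane → EuclideanSpace ℂ (Fin 2)}
    (hu : MemLp u 2 volume) (hv : MemLp v 2 volume) (hG : MemLp G 2 volume)
    (hH : MemLp H 2 volume) (huG : HasWeakGradient u G) (hvH : HasWeakGradient v H) (t : ℝ) :
    HasWeakGradient (fun x => u x + t • v x) (fun x => G x + t • H x) := by
  intro φ hφ i
  have hint {f : Plane → ℂ} (hf : MemLp f 2 volume) {ψ : Plane → ℝ} (h1 : Continuous ψ)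
      (h2 : HasCompactSupport ψ) : Integrable (fun x => ψ x • f x) volume :=
    (hf.locallyIntegrable one_le_two).integrable_smul_left_of_hasCompactSupport h1 h2
  have hd1 := hφ.continuous_partialDeriv i
  have hd2 := hφ.hasCompactSupport_partialDeriv i
  have hc := hφ.1.continuous
  have iv : Integrable (fun x => t • partialDeriv i φ x • v x) volume := (hint hv hd1 hd2).smul t
  have iH : Integrable (fun x => t • φ x • H x i) volume :=
    (hint (memLp_coord hH i) hc hφ.2).smul t
  simp only [smul_add, PiLp.add_apply, PiLp.smul_apply, smul_comm _ t]
  rw [integral_add (hint hu hd1 hd2) iv, integral_add (hint (memLp_coord hG i) hc hφ.2) iH,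
    integral_smul, integral_smul, huG φ hφ i, hvH φ hφ i, smul_neg, neg_add]

theorem MemH1.add_smul {u : Plane → ℂ} (hu : MemH1 u) {φ : Plane → ℝ} (hφ : IsTestFunction φ)
    (t : ℝ) : MemH1 (fun x => u x + t • (φ x : ℂ)) :=
  ⟨hu.1.add ((hφ.memLp 2).ofReal.const_smul t), _,
    hu.memLp_weakGradient.add (hφ.memLp_classicalGradient.const_smul t),
    hasWeakGradient_add_smul hu.1 (hφ.memLp 2).ofReal hu.memLp_weakGradient
      hφ.memLp_classicalGradient hu.hasWeakGradient hφ.hasWeakGradient t⟩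

theorem weakGradient_add_smul {u : Plane → ℂ} (hu : MemH1 u) {φ : Plane → ℝ}
    (hφ : IsTestFunction φ) (t : ℝ) :
    weakGradient (fun x => u x + t • (φ x : ℂ)) =ᵐ[volume]
      fun x => weakGradient u x + t • classicalGradient φ x :=
  (hu.add_smul hφ t).hasWeakGradient.ae_eq
    (hasWeakGradient_add_smul hu.1 (hφ.memLp 2).ofReal hu.memLp_weakGradient
      hφ.memLp_classicalGradient hu.hasWeakGradient hφ.hasWeakGradient t)
    (hu.add_smul hφ t).memLp_weakGradient
    (hu.memLp_weakGradient.add (hφ.memLp_classicalGradient.const_smul t))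

theorem gradNorm_sq {u : Plane → ℂ} (hu : MemH1 u) :
    gradNorm u ^ 2 = ∫ x, ‖weakGradient u x‖ ^ 2 :=
  lpNorm_pow_eq_integral 2 two_ne_zero hu.memLp_weakGradient.1

theorem gradNorm_sq_add_smul {u : Plane → ℂ} (hu : MemH1 u) {φ : Plane → ℝ}
    (hφ : IsTestFunction φ) (t : ℝ) :
    gradNorm (fun x => u x + t • (φ x : ℂ)) ^ 2 =
      ∑ i, ((∫ x, ((weakGradient u x i).re + t * partialDeriv i φ x) ^ 2) +
        ∫ x, (weakGradient u x i).im ^ 2) := by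
  rw [gradNorm_sq (hu.add_smul hφ t)]
  have hre (i : Fin 2) : MemLp (fun x => (weakGradient u x i).re + t * partialDeriv i φ x) 2 volume :=
    (memLp_coord hu.memLp_weakGradient i).re.add ((hφ.memLp_partialDeriv i 2).const_mul t)
  have him (i : Fin 2) : MemLp (fun x => (weakGradient u x i).im) 2 volume :=
    (memLp_coord hu.memLp_weakGradient i).im
  have h (i : Fin 2) := integral_add (hre i).integrable_sq (him i).integrable_sq
  simp_rw [← h]
  have hadd (i : Fin 2) : Integrable (fun x => ((weakGradient u x i).re + t * partialDeriv i φ x) ^ 2 +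
      (weakGradient u x i).im ^ 2) volume := (hre i).integrable_sq.add (him i).integrable_sq
  rw [← integral_finsetSum _ fun i _ => hadd i]
  refine integral_congr_ae ?_
  filter_upwards [weakGradient_add_smul hu hφ t] with x hx
  rw [hx, EuclideanSpace.norm_sq_eq]
  refine Finset.sum_congr rfl fun i _ => ?_
  rw [← Complex.normSq_eq_norm_sq, Complex.normSq_apply]
  simp [classicalGradient, pow_two]

/-- The `L²` pairing of `∇φ` with the real part of the weak gradient of `u`. -/
noncomputable def gradPairing (u : Plane → ℂ) (φ : Plane → ℝ) : ℝ :=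
  ∑ i, ∫ x, (weakGradient u x i).re * partialDeriv i φ x

theorem hasDerivAt_gradNorm_sq {u : Plane → ℂ} (hu : MemH1 u) {φ : Plane → ℝ}
    (hφ : IsTestFunction φ) :
    HasDerivAt (fun t : ℝ => gradNorm (fun x => u x + t • (φ x : ℂ)) ^ 2)
      (2 * gradPairing u φ) 0 := by
  simp_rw [gradNorm_sq_add_smul hu hφ]
  have h := HasDerivAt.fun_sum (u := Finset.univ)
    (A := fun (i : Fin 2) (t : ℝ) =>
      (∫ x, ((weakGradient u x i).re + t * partialDeriv i φ x) ^ 2) +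
        ∫ x, (weakGradient u x i).im ^ 2) (x := (0 : ℝ))
    fun i _ => (hasDerivAt_integral_add_mul_pow 1
      (f := fun x => (weakGradient u x i).re) (g := partialDeriv i φ)
      (by simpa using (memLp_coord hu.memLp_weakGradient i).re)
      (by simpa using hφ.memLp_partialDeriv i 2)).add_const _
  refine h.congr_deriv ?_
  rw [gradPairing, Finset.mul_sum]
  refine Finset.sum_congr rfl fun i _ => ?_
  norm_num

section RealValued

variable {u : Plane → ℂ} {φ : Plane → ℝ}

theorem lpNorm_pow_add_smul (n : ℕ) (hn : Even n) (hn0 : n ≠ 0)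
    (hu : AEStronglyMeasurable u volume) (hre : ∀ᵐ x, (u x).im = 0)
    (hφ : IsTestFunction φ) (t : ℝ) :
    lpNorm (fun x => u x + t • (φ x : ℂ)) n volume ^ n =
      ∫ x, ((u x).re + t * φ x) ^ n := by
  have hv : AEStronglyMeasurable (fun x => u x + t • (φ x : ℂ)) volume :=
    hu.add ((hφ.memLp 2).ofReal.1.const_smul t)
  rw [lpNorm_pow_eq_integral n hn0 hv]
  refine integral_congr_ae ?_
  filter_upwards [hre] with x hx
  have : u x + t • (φ x : ℂ) = (((u x).re + t * φ x : ℝ) : ℂ) := by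
    apply Complex.ext <;> simp [hx]
  rw [this, Complex.norm_real, Real.norm_eq_abs, hn.pow_abs]

theorem hasDerivAt_lpNorm_pow (n : ℕ) (hn : Even (n + 1))
    (hu : MemLp u (n + 1 : ℕ) volume) (hre : ∀ᵐ x, (u x).im = 0) (hφ : IsTestFunction φ) :
    HasDerivAt (fun t : ℝ => lpNorm (fun x => u x + t • (φ x : ℂ)) (n + 1 : ℕ) volume ^ (n + 1))
      ((n + 1) * ∫ x, (u x).re ^ n * φ x) 0 := by
  simp_rw [lpNorm_pow_add_smul (n + 1) hn (by simp) hu.1 hre hφ]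
  exact hasDerivAt_integral_add_mul_pow n hu.re (hφ.memLp _)

end RealValued

theorem memLp_four_of_memLp_two_six {u : Plane → ℂ} (h2 : MemLp u 2 volume)
    (h6 : MemLp u 6 volume) : MemLp u 4 volume := by
  have h2' := h2.integrable_norm_pow two_ne_zero
  have h6' := h6.integrable_norm_pow (p := 6) (by norm_num)
  have h4 : Integrable (fun x => ‖u x‖ ^ 4) volume := by
    refine (h2'.add h6').mono' (h2.1.norm.pow 4) (.of_forall fun x => ?_)
    simp only [Pi.add_apply]
    rw [Real.norm_of_nonneg (by positivity)]
    nlinarith [sq_nonneg (‖u x‖ * (‖u x‖ ^ 2 - 1)), sq_nonneg (‖u x‖ ^ 3), sq_nonneg ‖u x‖]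
  rw [← integrable_norm_rpow_iff h2.1 (by norm_num) (by norm_num)]
  refine h4.congr (.of_forall fun x => ?_)
  simp only [ENNReal.toReal_ofNat]
  norm_cast

/-- A positive square-integrable function on the plane is not constant, hence its cube and its
fifth power are linearly independent. -/
theorem eq_zero_of_integral_pow_eq {q : Plane → ℝ} (hq : ∀ᵐ x, 0 < q x) (h2 : MemLp q 2 volume)
    (h5 : LocallyIntegrable (fun x => q x ^ 5) volume)
    (h3 : LocallyIntegrable (fun x => q x ^ 3) volume) {X Y : ℝ}
    (h : ∀ φ, IsTestFunction φ → X * ∫ x, q x ^ 5 * φ x = Y * ∫ x, q x ^ 3 * φ x) :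
    X = 0 ∧ Y = 0 := by
  have hae : ∀ᵐ x, X • q x ^ 5 = Y • q x ^ 3 :=
    ae_eq_of_integral_contDiff_smul_eq (h5.smul X) (h3.smul Y) fun φ h1 h2 => by
      have := h φ ⟨h1, h2⟩
      rw [← integral_const_mul, ← integral_const_mul] at this
      simpa [mul_comm, mul_left_comm] using this
  have hsq : ∀ᵐ x, X * q x ^ 2 = Y ∧ 0 < q x := by
    filter_upwards [hae, hq] with x hx hpos
    refine ⟨?_, hpos⟩
    have : (X * q x ^ 2 - Y) * q x ^ 3 = 0 := by simp only [smul_eq_mul] at hx; linear_combination hx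
    exact sub_eq_zero.1 ((mul_eq_zero.1 this).resolve_right (by positivity))
  have hX : X = 0 := by
    by_contra hX
    have hint : Integrable (fun _ : Plane => Y / X) volume := by
      refine h2.integrable_sq.congr ?_
      filter_upwards [hsq] with x hx
      rw [← hx.1]; field_simp
    rw [integrable_const_iff] at hint
    rcases hint with h0 | hfin
    · obtain ⟨x, hx⟩ := hsq.exists
      have hY : Y = 0 := by simpa [hX] using h0
      have := hx.1
      rw [hY] at this
      have := hx.2
      simp_all
    · exact absurd hfin.1 (by simp [measure_univ_of_isAddLeftInvariant])
  obtain ⟨x, hx⟩ := hsq.exists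
  exact ⟨hX, by simpa [hX] using hx.1.symm⟩

namespace IsNormalizedMinimizer

variable {α : ℝ} {Q : Plane → ℂ}

theorem memLp_four (h : IsNormalizedMinimizer α Q) : MemLp Q 4 volume :=
  memLp_four_of_memLp_two_six h.memH1.1 h.memH1.memLp_six

theorem not_ae_eq_zero (h : IsNormalizedMinimizer α Q) : ¬ Q =ᵐ[volume] 0 := fun h0 => by
  obtain ⟨x, hx, hx0⟩ := (h.pos.and h0).exists
  simp [hx0] at hx

theorem lpNorm_pos (h : IsNormalizedMinimizer α Q) {p : ENNReal} (hp : p ≠ 0)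
    (hQ : MemLp Q p volume) : 0 < lpNorm Q p volume :=
  lpNorm_nonneg.lt_of_ne' fun h0 => h.not_ae_eq_zero ((lpNorm_eq_zero hQ hp).1 h0)

theorem locallyIntegrable_pow (h : IsNormalizedMinimizer α Q) {n : ℕ} (hn : n ≤ 6) :
    LocallyIntegrable (fun x => (Q x).re ^ n) volume := by
  rw [locallyIntegrable_iff]
  intro K hK
  have : IsFiniteMeasure (volume.restrict K) := ⟨by simpa using hK.measure_lt_top⟩
  have h6 : MemLp (fun x => (Q x).re) 6 (volume.restrict K) := h.memH1.memLp_six.re.restrict K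
  have hn' : MemLp (fun x => (Q x).re) n (volume.restrict K) :=
    h6.mono_exponent (by exact_mod_cast hn)
  rcases eq_or_ne n 0 with rfl | hn0
  · simp [IntegrableOn]
  · refine (hn'.integrable_norm_pow hn0).mono' (h6.1.pow n) (.of_forall fun x => ?_)
    rw [norm_pow]

theorem weak_equation (h : IsNormalizedMinimizer α Q) {φ : Plane → ℝ} (hφ : IsTestFunction φ) :
    gradPairing Q φ + ((∫ x, (Q x).re ^ 5 * φ x) - (∫ x, (Q x).re ^ 3 * φ x) +
      (2 + α) / 2 * (gradNorm Q ^ 2 / lpNorm Q 2 volume ^ 2) * ∫ x, (Q x).re ^ 1 * φ x) = 0 := by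
  set w := (2 + α) / 2 * (gradNorm Q ^ 2 / lpNorm Q 2 volume ^ 2)
  have hpow (n : ℕ) (hn : n ≤ 6) : Integrable (fun x => (Q x).re ^ n * φ x) volume := by
    refine ((h.locallyIntegrable_pow hn).integrable_smul_left_of_hasCompactSupport
      hφ.1.continuous hφ.2).congr (.of_forall fun x => ?_)
    simp [mul_comm]
  have hG (i : Fin 2) : Integrable (fun x => partialDeriv i φ x • weakGradient Q x i) volume :=
    ((memLp_coord h.memH1.memLp_weakGradient i).locallyIntegrable
      one_le_two).integrable_smul_left_of_hasCompactSupport (hφ.continuous_partialDeriv i)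
      (hφ.hasCompactSupport_partialDeriv i)
  have hsub : Integrable (fun x => (Q x).re ^ 5 * φ x - (Q x).re ^ 3 * φ x) volume :=
    (hpow 5 (by norm_num)).sub (hpow 3 (by norm_num))
  have hint : Integrable (fun x => (Q x).re ^ 5 * φ x - (Q x).re ^ 3 * φ x +
      w * ((Q x).re ^ 1 * φ x)) volume :=
    hsub.add ((hpow 1 (by norm_num)).const_mul w)
  have hintC : Integrable (fun x => (((Q x).re ^ 5 * φ x - (Q x).re ^ 3 * φ x +
      w * ((Q x).re ^ 1 * φ x) : ℝ) : ℂ)) volume := hint.ofReal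
  have hsum : Integrable (fun x => ∑ i, partialDeriv i φ x • weakGradient Q x i) volume :=
    integrable_finsetSum _ fun i _ => hG i
  have heq := h.solves.2 φ hφ
  have hcongr : ∫ x, ((∑ i : Fin 2, partialDeriv i φ x • weakGradient Q x i) +
      φ x • (-((‖Q x‖ : ℂ) ^ 2 * Q x) + (‖Q x‖ : ℂ) ^ 4 * Q x + (w : ℂ) * Q x)) =
      ∫ x, ((∑ i : Fin 2, partialDeriv i φ x • weakGradient Q x i) +
        (((Q x).re ^ 5 * φ x - (Q x).re ^ 3 * φ x + w * ((Q x).re ^ 1 * φ x) : ℝ) : ℂ)) := by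
    refine integral_congr_ae ?_
    filter_upwards [h.pos] with x hx
    have hQ : Q x = ((Q x).re : ℂ) := Complex.ext (by simp) (by simp [hx.2])
    have hn : ‖Q x‖ = (Q x).re := by
      rw [hQ, Complex.norm_real, Real.norm_of_nonneg hx.1.le, Complex.ofReal_re]
    simp only [hn, Complex.real_smul]
    rw [hQ]
    push_cast
    simp only [Complex.ofReal_re]
    ring
  rw [hcongr, integral_add hsum hintC, integral_finsetSum _ fun i _ => hG i,
    integral_complex_ofReal] at heq
  have hre := congrArg Complex.re heq
  rw [Complex.add_re, Complex.re_sum, Complex.ofReal_re, Complex.zero_re, integral_add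
    hsub ((hpow 1 (by norm_num)).const_mul w),
    integral_sub (hpow 5 (by norm_num)) (hpow 3 (by norm_num)), integral_const_mul] at hre
  rw [← hre, gradPairing]
  congr 1
  refine Finset.sum_congr rfl fun i _ => ?_
  have := integral_re (hG i)
  simp only [RCLike.re_to_complex] at this
  rw [← this]
  simp [mul_comm]

theorem gradNorm_pos (h : IsNormalizedMinimizer α Q) : 0 < gradNorm Q := by
  refine (show 0 ≤ gradNorm Q from lpNorm_nonneg).lt_of_ne' fun h0 => ?_
  have hG := (lpNorm_eq_zero h.memH1.memLp_weakGradient two_ne_zero).1 h0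
  have hpair (φ : Plane → ℝ) : gradPairing Q φ = 0 := by
    refine Finset.sum_eq_zero fun i _ => integral_eq_zero_of_ae ?_
    filter_upwards [hG] with x hx
    simp [hx]
  refine one_ne_zero (α := ℝ) (eq_zero_of_integral_pow_eq (h.pos.mono fun x hx => hx.1)
    h.memH1.1.re (h.locallyIntegrable_pow (by norm_num)) (h.locallyIntegrable_pow (by norm_num))
    (X := 1) (Y := 1) fun φ hφ => ?_).1
  have := h.weak_equation hφ
  rw [hpair, h0] at this
  norm_num at this
  linarith

/-- The Euler–Lagrange equation of `F_α` at a minimizer. -/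
theorem euler_lagrange (hα : 0 < α) (h : IsNormalizedMinimizer α Q) {φ : Plane → ℝ}
    (hφ : IsTestFunction φ) :
    2 * (2 * gradPairing Q φ / gradNorm Q ^ 2) +
      (2 + α) * (2 * (∫ x, (Q x).re ^ 1 * φ x) / lpNorm Q 2 volume ^ 2) +
      α * (6 * (∫ x, (Q x).re ^ 5 * φ x) / lpNorm Q 6 volume ^ 6) -
      2 * (1 + α) * (4 * (∫ x, (Q x).re ^ 3 * φ x) / lpNorm Q 4 volume ^ 4) = 0 := by
  have him : ∀ᵐ x, (Q x).im = 0 := h.pos.mono fun x hx => hx.2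
  let v : ℝ → Plane → ℂ := fun t x => Q x + t • (φ x : ℂ)
  have hv0 : v 0 = Q := by simp [v]
  have da := hasDerivAt_gradNorm_sq h.memH1 hφ
  have dm := hasDerivAt_lpNorm_pow 1 (by decide) (by simpa using h.memH1.1) him hφ
  have db := hasDerivAt_lpNorm_pow 5 (by decide) (by simpa using h.memH1.memLp_six) him hφ
  have dc := hasDerivAt_lpNorm_pow 3 (by decide) (by simpa using h.memLp_four) him hφ
  norm_num at dm db dc
  change HasDerivAt (fun t => gradNorm (v t) ^ 2) _ 0 at da
  replace dm : HasDerivAt (fun t => lpNorm (v t) 2 volume ^ 2)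
    (2 * ∫ x, (Q x).re ^ 1 * φ x) 0 := by simpa [v] using dm
  replace db : HasDerivAt (fun t => lpNorm (v t) 6 volume ^ 6)
    (6 * ∫ x, (Q x).re ^ 5 * φ x) 0 := by simpa [v] using db
  replace dc : HasDerivAt (fun t => lpNorm (v t) 4 volume ^ 4)
    (4 * ∫ x, (Q x).re ^ 3 * φ x) 0 := by simpa [v] using dc
  have pa := h.gradNorm_pos
  have pm := h.lpNorm_pos two_ne_zero h.memH1.1
  have pb := h.lpNorm_pos (by norm_num) h.memH1.memLp_six
  have pc := h.lpNorm_pos (by norm_num) h.memLp_four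
  have hmin : IsLocalMin (fun t => logQuotient α (gradNorm (v t) ^ 2) (lpNorm (v t) 2 volume ^ 2)
      (lpNorm (v t) 6 volume ^ 6) (lpNorm (v t) 4 volume ^ 4)) 0 := by
    have hev {f : ℝ → ℝ} {f' : ℝ} {n : ℕ} (hn : n ≠ 0) (hf : HasDerivAt (fun t => f t ^ n) f' 0)
        (h0 : 0 < f 0) (hnn : ∀ t, 0 ≤ f t) : ∀ᶠ t in 𝓝 0, 0 < f t := by
      filter_upwards [hf.continuousAt.eventually (lt_mem_nhds (pow_pos h0 n))] with t ht
      exact (hnn t).lt_of_ne' fun h => by simp [h, hn] at ht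
    filter_upwards [hev two_ne_zero da (by rwa [hv0]) fun t => lpNorm_nonneg,
      hev two_ne_zero dm (by rwa [hv0]) fun t => lpNorm_nonneg,
      hev (by norm_num) db (by rwa [hv0]) fun t => lpNorm_nonneg,
      hev (by norm_num) dc (by rwa [hv0]) fun t => lpNorm_nonneg] with t ta tm tb tc
    rw [hv0, ← log_functionalF hα pa pm pb pc, ← log_functionalF hα ta tm tb tc]
    have hne : ¬ v t =ᵐ[volume] 0 := fun h0 => by
      exact tm.ne' ((lpNorm_eq_zero (h.memH1.add_smul hφ t).1 two_ne_zero).2 h0)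
    have hle := infimumC_le α (h.memH1.add_smul hφ t) hne
    rw [← h.minimizes] at hle
    have := Real.log_le_log (functionalF_pos pa pm pb pc) hle
    gcongr
  have hder := ((((da.log (by rw [hv0]; positivity)).const_mul 2).add
    ((dm.log (by rw [hv0]; positivity)).const_mul (2 + α))).add
    ((db.log (by rw [hv0]; positivity)).const_mul α)).sub
    ((dc.log (by rw [hv0]; positivity)).const_mul (2 * (1 + α)))
  have := hmin.hasDerivAt_eq_zero hder
  simpa only [hv0] using this

/-- The virial identities `‖Q‖₆⁶ = (3α/2) ‖∇Q‖₂²` and `‖Q‖₄⁴ = 2(1+α) ‖∇Q‖₂²`. -/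
theorem virial (hα : 0 < α) (h : IsNormalizedMinimizer α Q) :
    lpNorm Q 6 volume ^ 6 = 3 / 2 * α * gradNorm Q ^ 2 ∧
      lpNorm Q 4 volume ^ 4 = 2 * (1 + α) * gradNorm Q ^ 2 := by
  have pa := h.gradNorm_pos
  have pm := h.lpNorm_pos two_ne_zero h.memH1.1
  have pb := h.lpNorm_pos (by norm_num) h.memH1.memLp_six
  have pc := h.lpNorm_pos (by norm_num) h.memLp_four
  obtain ⟨hX, hY⟩ := eq_zero_of_integral_pow_eq (h.pos.mono fun x hx => hx.1)
    h.memH1.1.re (h.locallyIntegrable_pow (by norm_num)) (h.locallyIntegrable_pow (by norm_num))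
    (X := 6 * α / lpNorm Q 6 volume ^ 6 - 4 / gradNorm Q ^ 2)
    (Y := 8 * (1 + α) / lpNorm Q 4 volume ^ 4 - 4 / gradNorm Q ^ 2) fun φ hφ => by
      have e1 := h.weak_equation hφ
      have e2 := h.euler_lagrange hα hφ
      have e3 : 4 / gradNorm Q ^ 2 * ((2 + α) / 2 * (gradNorm Q ^ 2 / lpNorm Q 2 volume ^ 2)) =
        2 * (2 + α) / lpNorm Q 2 volume ^ 2 := by field_simp; ring
      linear_combination e2 - 4 / gradNorm Q ^ 2 * e1 + (∫ x, (Q x).re ^ 1 * φ x) * e3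
  rw [sub_eq_zero, div_eq_div_iff (by positivity) (by positivity)] at hX hY
  constructor <;> linarith

theorem lt_of_lt {β : ℝ} {R : Plane → ℂ} (hα : 0 < α) (hαβ : α < β)
    (hQ : IsNormalizedMinimizer α Q) (hR : IsNormalizedMinimizer β R) :
    gradNorm Q ^ 2 < gradNorm R ^ 2 ∧ lpNorm Q 2 volume ^ 2 < lpNorm R 2 volume ^ 2 := by
  have key {γ δ : ℝ} {U V : Plane → ℂ} (hγ : 0 < γ) (hδ : 0 < δ) (hU : IsNormalizedMinimizer γ U)
      (hV : IsNormalizedMinimizer δ V) :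
      logQuotient γ (gradNorm U ^ 2) (lpNorm U 2 volume ^ 2) (3 / 2 * γ * gradNorm U ^ 2)
        (2 * (1 + γ) * gradNorm U ^ 2) ≤
      logQuotient γ (gradNorm V ^ 2) (lpNorm V 2 volume ^ 2) (3 / 2 * δ * gradNorm V ^ 2)
        (2 * (1 + δ) * gradNorm V ^ 2) := by
    have ua := hU.gradNorm_pos
    have um := hU.lpNorm_pos two_ne_zero hU.memH1.1
    have ub := hU.lpNorm_pos (by norm_num) hU.memH1.memLp_six
    have uc := hU.lpNorm_pos (by norm_num) hU.memLp_four
    have va := hV.gradNorm_pos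
    have vm := hV.lpNorm_pos two_ne_zero hV.memH1.1
    have vb := hV.lpNorm_pos (by norm_num) hV.memH1.memLp_six
    have vc := hV.lpNorm_pos (by norm_num) hV.memLp_four
    rw [← (hU.virial hγ).1, ← (hU.virial hγ).2, ← (hV.virial hδ).1, ← (hV.virial hδ).2,
      ← log_functionalF hγ ua um ub uc, ← log_functionalF hγ va vm vb vc]
    have hle := infimumC_le γ hV.memH1 hV.not_ae_eq_zero
    rw [← hU.minimizes] at hle
    have := Real.log_le_log (functionalF_pos ua um ub uc) hle
    gcongr
  have hβ := hα.trans hαβ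
  have qa := hQ.gradNorm_pos
  have qm := hQ.lpNorm_pos two_ne_zero hQ.memH1.1
  have ra := hR.gradNorm_pos
  have rm := hR.lpNorm_pos two_ne_zero hR.memH1.1
  exact lt_of_logQuotient_le hα hαβ (by positivity) (by positivity) (by positivity) (by positivity)
    (key hα hβ hQ hR) (key hβ hα hR hQ)

end IsNormalizedMinimizer

end CubicQuintic

theorem theorem4p1 (S : Set ℝ) (hS : S ⊆ Set.Ioi 0)
    (Q : ℝ → CubicQuintic.Plane → ℂ)
    (hQ : ∀ α ∈ S, CubicQuintic.IsNormalizedMinimizer α (Q α)) :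
    StrictMonoOn (fun α => CubicQuintic.gradNorm (Q α) ^ 2) S ∧
      StrictMonoOn (fun α => MeasureTheory.lpNorm (Q α) 2 MeasureTheory.volume ^ 2) S :=
  ⟨fun _ hα _ hβ hαβ => ((hQ _ hα).lt_of_lt (hS hα) hαβ (hQ _ hβ)).1,
    fun _ hα _ hβ hαβ => ((hQ _ hα).lt_of_lt (hS hα) hαβ (hQ _ hβ)).2⟩
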